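/- Let $d\ge 1$, let $A,B\in\mathbb R^{d\times d}$ be symmetric positive-definite, and let $\mu=N_d(A)$, $\nu=N_d(B)$ be the centered Gaussian measures on $\mathbb R^d$ with covariance matrices $A$ and $B$. Let $\Sigma\in\mathbb R^{2d\times 2d}$ be symmetric positive-definite, with $d\times d$ blocks $$\Sigma=\begin{pmatrix}A_{\rm ref}&C_{\rm ref}\\ C_{\rm ref}^T&B_{\rm ref}\end{pmatrix},\qquad \Gamma:=\Sigma^{-1}=\begin{pmatrix}\Gamma_{11}&\Gamma_{12}\\ \Gamma_{12}^T&\Gamma_{22}\end{pmatrix},$$ and let $\varepsilon>0$. Define the entropic optimal transport cost $$W_\Sigma^\varepsilon(\mu,\nu):=\inf_{\pi\in\Pi(\mu,\nu)}\left\{\int_{\mathbb R^d\times\mathbb R^d}\|x-y\|^2\,d\pi(x,y)+2\varepsilon\,\mathrm{KL}\big(\pi\,|\,N_{2d}(\Sigma)\big)\right\},$$ where $\Pi(\mu,\nu)$ is the set of all probability measures on $\mathbb R^d\times\mathbb R^d$ with marginals $\mu$ and $\nu$, $N_{2d}(\Sigma)$ is the centered Gaussian measure with covariance $\Sigma$,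 and $\mathrm{KL}(\pi|\rho)=\int\log\frac{d\pi}{d\rho}\,d\pi$ if $\pi\ll\rho$ and $+\infty$ otherwise. Put $M_\varepsilon:=I_d-\varepsilon\Gamma_{12}$ and $$\Big(AM_\varepsilon BM_\varepsilon^T+\tfrac{\varepsilon^2}{4}I_d\Big)^{1/2}:=A^{1/2}\Big(A^{1/2}M_\varepsilon BM_\varepsilon^TA^{1/2}+\tfrac{\varepsilon^2}{4}I_d\Big)^{1/2}A^{-1/2},$$ the roots on the right being the positive-semidefinite ones. Then $W_\Sigma^\varepsilon(\mu,\nu)$ is finite and $$\begin{aligned}W_\Sigma^{\varepsilon}(\mu,\nu)={}&\operatorname{tr}A+\operatorname{tr}B-2\operatorname{tr}\Big(\big(AM_\varepsilon BM_\varepsilon^T+\tfrac{\varepsilon^2}{4}I_d\big)^{1/2}\Big)+\varepsilon\log\det\Big(\big(AM_\varepsilon BM_\varepsilon^T+\tfrac{\varepsilon^2}{4}I_d\big)^{1/2}+\tfrac{\varepsilon}{2}I_d\Big)\\&+\varepsilon\operatorname{tr}(\Gamma_{11}A)+\varepsilon\operatorname{tr}(\Gamma_{22}B)-\varepsilon\log\det(AB)-\varepsilon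 d-\varepsilon d\log\varepsilon-\varepsilon\log\det(\Sigma^{-1}).\end{aligned}$$ Moreover $$M_\varepsilon=I_d+\varepsilon A_{\rm ref}^{-1}C_{\rm ref}\big(B_{\rm ref}-C_{\rm ref}^TA_{\rm ref}^{-1}C_{\rm ref}\big)^{-1}.$$ -/

import Mathlib

open MeasureTheory ProbabilityTheory InformationTheory
open scoped ENNReal Matrix MatrixOrder

noncomputable section

namespace GaussianEOT

/-- The ambient Euclidean space `ℝ^d`. -/
abbrev Space (d : ℕ) : Type := EuclideanSpace ℝ (Fin d)

/-- The set `Π(μ, ν)` of couplings: probability measures on `ℝ^d × ℝ^d` with first marginal `μ`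
and second marginal `ν`. -/
def couplings {d : ℕ} (μ ν : Measure (Space d)) : Set (Measure (Space d × Space d)) :=
  {π | IsProbabilityMeasure π ∧ π.map Prod.fst = μ ∧ π.map Prod.snd = ν}

/-- The centered Gaussian measure `N_d(A)` on `ℝ^d` with covariance matrix `A`. -/
def gaussian {d : ℕ} (A : Matrix (Fin d) (Fin d) ℝ) : Measure (Space d) :=
  multivariateGaussian 0 A

/-- The centered Gaussian measure `N_{2d}(S)` on `ℝ^d × ℝ^d` whose covariance matrix is the
`2d × 2d` block matrix `S`; the first `d` coordinates (`Sum.inl`) belong to the first factor and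
the last `d` coordinates (`Sum.inr`) to the second. -/
def jointGaussian {d : ℕ} (S : Matrix (Fin d ⊕ Fin d) (Fin d ⊕ Fin d) ℝ) :
    Measure (Space d × Space d) :=
  (multivariateGaussian 0 S).map
    (EuclideanSpace.sumEquivProd (𝕜 := ℝ) (ι := Fin d) (κ := Fin d))

/-- The objective `∫ ‖x - y‖² dπ(x, y) + 2 ε KL(π | N_{2d}(S))`, with values in `[0, ∞]`. -/
def objective {d : ℕ} (ε : ℝ) (S : Matrix (Fin d ⊕ Fin d) (Fin d ⊕ Fin d) ℝ)
    (π : Measure (Space d × Space d)) : ℝ≥0∞ :=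
  ∫⁻ p, ENNReal.ofReal (‖p.1 - p.2‖ ^ 2) ∂π + ENNReal.ofReal (2 * ε) * klDiv π (jointGaussian S)

/-- The entropic optimal transport cost `W_S^ε(μ, ν)`: the infimum of the objective over all
couplings of `μ` and `ν`. -/
def cost {d : ℕ} (ε : ℝ) (S : Matrix (Fin d ⊕ Fin d) (Fin d ⊕ Fin d) ℝ)
    (μ ν : Measure (Space d)) : ℝ≥0∞ :=
  ⨅ π ∈ couplings μ ν, objective ε S π

/-- The matrix `M_ε = I_d - ε Γ₁₂`, where `Γ₁₂` is the upper right block of `Γ = S⁻¹`. -/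
def Meps {d : ℕ} (ε : ℝ) (S : Matrix (Fin d ⊕ Fin d) (Fin d ⊕ Fin d) ℝ) :
    Matrix (Fin d) (Fin d) ℝ :=
  1 - ε • (S⁻¹).toBlocks₁₂

/-- The matrix `(A M B Mᵀ + (ε² / 4) I_d)^{1/2}`, which for a not necessarily symmetric
`A M B Mᵀ` is defined as
`A^{1/2} (A^{1/2} M B Mᵀ A^{1/2} + (ε² / 4) I_d)^{1/2} A^{-1/2}`;
the square roots in this formula are those of positive semidefinite matrices. -/
def regRoot {d : ℕ} (ε : ℝ) (A B M : Matrix (Fin d) (Fin d) ℝ) : Matrix (Fin d) (Fin d) ℝ :=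
  CFC.sqrt A * CFC.sqrt (CFC.sqrt A * M * B * Mᵀ * CFC.sqrt A + (ε ^ 2 / 4) • 1) * (CFC.sqrt A)⁻¹

end GaussianEOT

end

/-! The proof is a duality argument with an explicit optimizer. If `G` satisfies `∫ exp G dρ = 1`,
Gibbs' inequality gives `KL(π | ρ) ≥ ∫ G dπ`, with equality at `π = exp(G) ρ`. Take `ρ = N(S)` and
`G` the log-density of a Gaussian `N(T)` whose diagonal blocks are `A` and `B`. If the upper right
block of `T⁻¹` is `-ε⁻¹ M_ε`, then that of `S⁻¹ - T⁻¹` is `ε⁻¹ I`, so `‖x - y‖² + 2ε G` has no cross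
term in `x, y`. Its integral is then the same for all couplings, bounds the objective from below,
and is attained at `N(T)`.

What remains is to find `T` (`exists_coupling_covariance`), to run the duality (`cost_eq`), and to
evaluate the common value from the blocks of `T⁻¹ T = 1` and from `det T`. -/

namespace GaussianEOT
-- Block matrices and the optimal covariance.
section Matrices

open Matrix

variable {d : ℕ}

theorem toBlocks₂₁_eq_transpose_of_isHermitian {S : Matrix (Fin d ⊕ Fin d) (Fin d ⊕ Fin d) ℝ}
    (hS : S.IsHermitian) : S.toBlocks₂₁ = (S.toBlocks₁₂)ᵀ := by
  ext i j
  exact (hS.apply (Sum.inr i) (Sum.inl j)).symm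

theorem inv_toBlocks₁₂_of_posDef {S : Matrix (Fin d ⊕ Fin d) (Fin d ⊕ Fin d) ℝ}
    (hS : S.PosDef) :
    (S⁻¹).toBlocks₁₂ = -((S.toBlocks₁₁)⁻¹ * S.toBlocks₁₂ *
        (S.toBlocks₂₂ - (S.toBlocks₁₂)ᵀ * (S.toBlocks₁₁)⁻¹ * S.toBlocks₁₂)⁻¹) := by
  have h11 : S.toBlocks₁₁.PosDef := hS.submatrix Sum.inl_injective
  have hu := hS.isUnit
  have hb : fromBlocks S.toBlocks₁₁ S.toBlocks₁₂ (S.toBlocks₁₂)ᵀ S.toBlocks₂₂ = S := by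
    rw [← toBlocks₂₁_eq_transpose_of_isHermitian hS.isHermitian, fromBlocks_toBlocks]
  rw [← hb] at hu
  have := hu.invertible
  have := h11.isUnit.invertible
  have := (isUnit_fromBlocks_iff_of_invertible₁₁.1 hu).invertible
  have key := congrArg toBlocks₁₂
    (invOf_fromBlocks₁₁_eq S.toBlocks₁₁ S.toBlocks₁₂ (S.toBlocks₁₂)ᵀ S.toBlocks₂₂)
  simpa only [invOf_eq_nonsing_inv, hb, toBlocks_fromBlocks₁₂] using key

theorem posDef_sqrt {A : Matrix (Fin d) (Fin d) ℝ} (hA : A.PosDef) : (CFC.sqrt A).PosDef := by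
  have h0 : (CFC.sqrt A).PosSemidef := nonneg_iff_posSemidef.1 (CFC.sqrt_nonneg A)
  rw [h0.posDef_iff_isUnit]
  refine isUnit_of_mul_isUnit_left (y := CFC.sqrt A) ?_
  rw [CFC.sqrt_mul_sqrt_self A hA.posSemidef.nonneg]
  exact hA.isUnit

/-- With `C` the off-diagonal block of `T`, block inversion turns the condition on `T⁻¹` into `C B⁻¹
= K M`, where `K = A - C B⁻¹ Cᵀ`. This is a quadratic equation for `K`, solved by `K = ε a Q⁻¹ a`
with `a = A^{1/2}` and `Q = R + ε/2`. The trace and determinant clauses are what the closed formula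
needs. -/
theorem exists_coupling_covariance {A B : Matrix (Fin d) (Fin d) ℝ} (hA : A.PosDef)
    (hB : B.PosDef) (M : Matrix (Fin d) (Fin d) ℝ) {ε : ℝ} (hε : 0 < ε) :
    ∃ T : Matrix (Fin d ⊕ Fin d) (Fin d ⊕ Fin d) ℝ, T.PosDef ∧ T.toBlocks₁₁ = A ∧
      T.toBlocks₂₂ = B ∧ (T⁻¹).toBlocks₁₂ = -(ε⁻¹ • M) ∧
      (M * (T.toBlocks₁₂)ᵀ).trace = (regRoot ε A B M).trace - ε / 2 * d ∧
      0 < (regRoot ε A B M + (ε / 2) • 1).det ∧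
      T.det * (regRoot ε A B M + (ε / 2) • 1).det = A.det * B.det * ε ^ d := by
  set a := CFC.sqrt A with ha
  set W : Matrix (Fin d) (Fin d) ℝ := a * M * B * Mᵀ * a + (ε ^ 2 / 4) • 1 with hW
  set R := CFC.sqrt W with hR
  have haP : a.PosDef := posDef_sqrt hA
  have haT : aᵀ = a := haP.isHermitian
  have haa : a * a = A := CFC.sqrt_mul_sqrt_self A hA.posSemidef.nonneg
  have hau : IsUnit a.det := (isUnit_iff_isUnit_det _).1 haP.isUnit
  have hBu : IsUnit B.det := (isUnit_iff_isUnit_det _).1 hB.isUnit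
  have hBT : Bᵀ = B := hB.isHermitian
  have hWP : W.PosSemidef := by
    refine PosSemidef.add ?_ (PosSemidef.one.smul (by positivity))
    have := hB.posSemidef.mul_mul_conjTranspose_same (a * M)
    simpa [conjTranspose_eq_transpose_of_trivial, transpose_mul, haT, mul_assoc] using this
  have hRR : R * R = W := CFC.sqrt_mul_sqrt_self W hWP.nonneg
  have hRP : R.PosSemidef := nonneg_iff_posSemidef.1 (CFC.sqrt_nonneg W)
  set Q : Matrix (Fin d) (Fin d) ℝ := R + (ε / 2) • 1 with hQ
  have hQP : Q.PosDef := PosDef.posSemidef_add hRP (PosDef.one.smul (by positivity))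
  have hQT : Qᵀ = Q := hQP.isHermitian
  have hQu : IsUnit Q.det := (isUnit_iff_isUnit_det _).1 hQP.isUnit
  have hQiT : (Q⁻¹)ᵀ = Q⁻¹ := by rw [transpose_nonsing_inv, hQT]
  -- Difference of squares: `R² - ε²/4 = (R - ε/2)(R + ε/2)`.
  have hfac : a * M * B * Mᵀ * a = (Q - ε • 1) * Q := by
    have h1 : a * M * B * Mᵀ * a = W - (ε ^ 2 / 4) • 1 := by rw [hW, add_sub_cancel_right]
    rw [h1, ← hRR, hQ]
    simp only [add_mul, sub_mul, mul_add, smul_mul_assoc, mul_smul_comm, one_mul, mul_one]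
    module
  have hfac' : a * M * B * Mᵀ * a * Q⁻¹ = Q - ε • 1 := by
    rw [hfac, mul_assoc, mul_nonsing_inv _ hQu, mul_one]
  set C := a * Q⁻¹ * a * M * B with hC
  have hCT : Cᵀ = B * Mᵀ * a * Q⁻¹ * a := by
    simp only [hC, transpose_mul, hBT, haT, hQiT, mul_assoc]
  set K := ε • (a * Q⁻¹ * a) with hK
  have hCB : C * B⁻¹ = a * Q⁻¹ * a * M := by
    rw [hC, mul_assoc, mul_nonsing_inv _ hBu, mul_one]
  have hschur : A - C * B⁻¹ * Cᵀ = K := by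
    have : C * B⁻¹ * Cᵀ = a * Q⁻¹ * (a * M * B * Mᵀ * a * Q⁻¹) * a := by
      rw [hCB, hCT]; simp only [mul_assoc]
    rw [this, hfac', mul_sub, mul_assoc a, nonsing_inv_mul _ hQu, hK, ← haa]
    simp [sub_mul, mul_assoc]
  have hKP : K.PosDef := by
    have := (hQP.inv).conjTranspose_mul_mul_same (B := a)
      (mulVec_injective_of_isUnit haP.isUnit)
    rw [conjTranspose_eq_transpose_of_trivial, haT] at this
    exact this.smul hε
  have hKinv : K⁻¹ = ε⁻¹ • (a⁻¹ * Q * a⁻¹) := by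
    refine inv_eq_left_inv ?_
    rw [hK, smul_mul_smul_comm, inv_mul_cancel₀ hε.ne', one_smul]
    rw [show a⁻¹ * Q * a⁻¹ * (a * Q⁻¹ * a) = a⁻¹ * (Q * (a⁻¹ * a * Q⁻¹)) * a by
      simp only [mul_assoc], nonsing_inv_mul _ hau, one_mul, mul_nonsing_inv _ hQu, mul_one,
      nonsing_inv_mul _ hau]
  have := hB.isUnit.invertible
  have hschur' : A - C * ⅟B * Cᵀ = K := by rw [invOf_eq_nonsing_inv, hschur]
  have hTu : IsUnit (fromBlocks A C Cᵀ B) := by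
    rw [isUnit_fromBlocks_iff_of_invertible₂₂, hschur']
    exact hKP.isUnit
  have hdet : regRoot ε A B M + (ε / 2) • 1 = a * Q * a⁻¹ := by
    rw [regRoot, hQ, mul_add, add_mul, mul_smul_comm, smul_mul_assoc, mul_one,
      mul_nonsing_inv _ hau]
  have hdet' : (regRoot ε A B M + (ε / 2) • 1).det = Q.det := by
    rw [hdet, det_conj haP.isUnit]
  refine ⟨fromBlocks A C Cᵀ B, ?_, by simp, by simp, ?_, ?_, ?_, ?_⟩
  · refine PosSemidef.posDef_iff_isUnit ?_ |>.2 hTu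
    rw [← conjTranspose_eq_transpose_of_trivial, PosDef.fromBlocks₂₂ _ _ hB,
      conjTranspose_eq_transpose_of_trivial, hschur]
    exact hKP.posSemidef
  · have := hTu.invertible
    have : Invertible (A - C * ⅟B * Cᵀ) := by rw [hschur']; exact hKP.isUnit.invertible
    have key := congrArg toBlocks₁₂ (invOf_fromBlocks₂₂_eq A C Cᵀ B)
    simp only [invOf_eq_nonsing_inv, toBlocks_fromBlocks₁₂, hschur] at key
    rw [key, hKinv, mul_assoc _ C, hCB, smul_mul_assoc]
    rw [show a⁻¹ * Q * a⁻¹ * (a * Q⁻¹ * a * M) = a⁻¹ * (Q * (a⁻¹ * a * Q⁻¹)) * a * M by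
      simp only [mul_assoc], nonsing_inv_mul _ hau, one_mul, mul_nonsing_inv _ hQu, mul_one,
      nonsing_inv_mul _ hau, one_mul]
  · have h1 : (M * Cᵀ).trace = (Q - ε • 1).trace := by
      rw [hCT, ← hfac', show M * (B * Mᵀ * a * Q⁻¹ * a) = (M * B * Mᵀ * a * Q⁻¹) * a by
        simp only [mul_assoc], trace_mul_comm]
      simp only [mul_assoc]
    have h2 : (regRoot ε A B M).trace = R.trace := by
      rw [regRoot, trace_mul_comm, ← mul_assoc, nonsing_inv_mul _ hau, one_mul]
    rw [toBlocks_fromBlocks₁₂, h1, h2, hQ]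
    simp
    ring
  · rw [hdet']; exact hQP.det_pos
  · rw [hdet', det_fromBlocks₂₂, hschur', hK, det_smul, det_mul, det_mul, Fintype.card_fin,
      ← haa, det_mul]
    have : Q⁻¹.det * Q.det = 1 := by rw [← det_mul, nonsing_inv_mul _ hQu, det_one]
    linear_combination B.det * ε ^ d * a.det * a.det * this

end Matrices

/-! ### Gibbs' variational inequality and its equality case. -/

section Gibbs

variable {α : Type*} {mα : MeasurableSpace α} {ρ π : Measure α} {G : α → ℝ}

/-- This is nonnegativity of the divergence of `π` from the probability measure `ρ.tilted G`. -/
theorem integral_le_integral_llr [IsProbabilityMeasure ρ] [IsProbabilityMeasure π]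
    (hG : Integrable (fun x ↦ Real.exp (G x)) ρ) (hG1 : ∫ x, Real.exp (G x) ∂ρ = 1)
    (hGπ : Integrable G π) (hac : π ≪ ρ) (hint : Integrable (llr π ρ) π) :
    ∫ x, G x ∂π ≤ ∫ x, llr π ρ x ∂π := by
  have := isProbabilityMeasure_tilted hG
  have hac' : π ≪ ρ.tilted G := hac.trans (absolutelyContinuous_tilted hG)
  have h0 := integral_llr_add_sub_measure_univ_nonneg hac'
    (integrable_llr_tilted_right hac hGπ hint hG)
  rw [integral_llr_tilted_right hac hGπ hG hint, hG1] at h0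
  simp only [Real.log_one, probReal_univ] at h0
  linarith

theorem llr_tilted_self [IsProbabilityMeasure ρ] (hm : Measurable G)
    (hG : Integrable (fun x ↦ Real.exp (G x)) ρ) (hG1 : ∫ x, Real.exp (G x) ∂ρ = 1) :
    llr (ρ.tilted G) ρ =ᵐ[ρ.tilted G] G := by
  refine (tilted_absolutelyContinuous ρ G).ae_le ?_
  filter_upwards [llr_tilted_left Measure.AbsolutelyContinuous.rfl hG hm.aemeasurable,
    llr_self ρ] with x hx hx0
  rw [hx, hx0, hG1]
  simp

end Gibbs

/-! ### Gaussian densities. -/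

section StdDensity

open Matrix Complex

/-- Both sides have the same characteristic function. The value of `c` is left unspecified, since
only ratios of densities are used. -/
theorem exists_stdGaussian_eq_withDensity (ι : Type*) [Fintype ι] :
    ∃ c : ℝ, 0 < c ∧ stdGaussian (EuclideanSpace ℝ ι) =
      volume.withDensity (fun x ↦ ENNReal.ofReal (c * Real.exp (-(‖x‖ ^ 2 / 2)))) := by
  set k : ℝ := (Real.pi / (1 / 2)) ^ ((Module.finrank ℝ (EuclideanSpace ℝ ι) : ℝ) / 2) with hk
  have hk0 : 0 < k := by positivity
  have hkC : ((Real.pi : ℂ) / ((1 / 2 : ℝ) : ℂ)) ^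
      ((Module.finrank ℝ (EuclideanSpace ℝ ι) : ℂ) / 2) = (k : ℂ) := by
    rw [hk, ofReal_cpow (by positivity)]
    push_cast
    rfl
  have hInt : Integrable (fun x : EuclideanSpace ℝ ι ↦ Real.exp (-(‖x‖ ^ 2 / 2))) := by
    have := (GaussianFourier.integrable_cexp_neg_mul_sq_norm_add (V := EuclideanSpace ℝ ι)
      (b := ((1 / 2 : ℝ) : ℂ)) (by norm_num) 0 0).re
    refine this.congr (ae_of_all _ fun x ↦ ?_)
    simp only [zero_mul, add_zero]
    rw [show -((1 / 2 : ℝ) : ℂ) * (‖x‖ : ℂ) ^ 2 = ((-(‖x‖ ^ 2 / 2) : ℝ) : ℂ) by push_cast; ring]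
    rw [← ofReal_exp]
    rfl
  refine ⟨k⁻¹, by positivity, ?_⟩
  have hfin : IsFiniteMeasure ((volume : Measure (EuclideanSpace ℝ ι)).withDensity
      (fun x ↦ ENNReal.ofReal (k⁻¹ * Real.exp (-(‖x‖ ^ 2 / 2))))) :=
    isFiniteMeasure_withDensity_ofReal (hInt.const_mul _).2
  apply Measure.ext_of_charFun
  ext t
  rw [charFun_stdGaussian, charFun_apply, integral_withDensity_eq_integral_toReal_smul
    (by fun_prop) (by simp)]
  have key := GaussianFourier.integral_cexp_neg_mul_sq_norm_add (V := EuclideanSpace ℝ ι)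
    (b := ((1 / 2 : ℝ) : ℂ)) (by norm_num) I t
  have : ∀ x : EuclideanSpace ℝ ι,
      (ENNReal.ofReal (k⁻¹ * Real.exp (-(‖x‖ ^ 2 / 2)))).toReal • cexp (inner ℝ x t * I) =
      (k : ℂ)⁻¹ * cexp (-((1 / 2 : ℝ) : ℂ) * (‖x‖ : ℂ) ^ 2 + I * inner ℝ t x) := by
    intro x
    rw [ENNReal.toReal_ofReal (by positivity), real_smul, exp_add, real_inner_comm]
    push_cast
    rw [mul_assoc]
    congr 3
    · ring_nf
    · ring_nf
  simp_rw [this]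
  rw [integral_const_mul, key, hkC, ← mul_assoc, inv_mul_cancel₀ (by exact_mod_cast hk0.ne'),
    one_mul]
  congr 1
  rw [I_sq]
  push_cast
  ring

end StdDensity

section Density

open Matrix

variable {ι : Type*} [Fintype ι] [DecidableEq ι]

theorem det_toEuclideanCLM (T : Matrix ι ι ℝ) :
    LinearMap.det (toEuclideanCLM (𝕜 := ℝ) T : EuclideanSpace ℝ ι →ₗ[ℝ] EuclideanSpace ℝ ι) =
      T.det :=
  LinearMap.det_toLin (PiLp.basisFun 2 ℝ ι) T

theorem det_sqrt {S : Matrix ι ι ℝ} (hS : S.PosDef) : (CFC.sqrt S).det = √S.det := by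
  have h0 : (CFC.sqrt S).PosSemidef := nonneg_iff_posSemidef.1 (CFC.sqrt_nonneg S)
  rw [eq_comm, Real.sqrt_eq_iff_mul_self_eq hS.posSemidef.det_nonneg h0.det_nonneg, ← det_mul,
    CFC.sqrt_mul_sqrt_self S hS.posSemidef.nonneg]

/-- Change of variables by `S^{1/2}`. The constant `c` is chosen before `S`, so it cancels between
two covariances. -/
theorem exists_multivariateGaussian_eq_withDensity (ι : Type*) [Fintype ι] [DecidableEq ι] :
    ∃ c : ℝ, 0 < c ∧ ∀ S : Matrix ι ι ℝ, S.PosDef → multivariateGaussian 0 S =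
      volume.withDensity (fun x : EuclideanSpace ℝ ι ↦
        ENNReal.ofReal (c * (√S.det)⁻¹ * Real.exp (-(x.ofLp ⬝ᵥ S⁻¹ *ᵥ x.ofLp / 2)))) := by
  obtain ⟨c, hc, h⟩ := exists_stdGaussian_eq_withDensity ι
  refine ⟨c, hc, fun S hS ↦ ?_⟩
  set T := CFC.sqrt S with hT
  have hTT : T * T = S := CFC.sqrt_mul_sqrt_self S hS.posSemidef.nonneg
  have hTP : T.PosSemidef := nonneg_iff_posSemidef.1 (CFC.sqrt_nonneg S)
  have hTt : Tᵀ = T := hTP.isHermitian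
  have hdet : T.det = √S.det := det_sqrt hS
  have hdet0 : 0 < √S.det := Real.sqrt_pos.2 hS.det_pos
  have hTu : IsUnit T.det := by rw [hdet]; exact hdet0.ne'.isUnit
  have hquad (x : EuclideanSpace ℝ ι) : (toEuclideanCLM (𝕜 := ℝ) T x).ofLp ⬝ᵥ
      S⁻¹ *ᵥ (toEuclideanCLM (𝕜 := ℝ) T x).ofLp = ‖x‖ ^ 2 := by
    rw [ofLp_toEuclideanCLM, mulVec_mulVec, ← hTT, Matrix.mul_inv_rev, Matrix.mul_assoc,
      nonsing_inv_mul _ hTu, Matrix.mul_one, dotProduct_mulVec, ← mulVec_transpose,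
      transpose_nonsing_inv, hTt, mulVec_mulVec, nonsing_inv_mul _ hTu, one_mulVec,
      EuclideanSpace.real_norm_sq_eq, dotProduct]
    exact Finset.sum_congr rfl fun i _ ↦ (sq _).symm
  have hmap := Measure.map_linearMap_addHaar_eq_smul_addHaar
    (volume : Measure (EuclideanSpace ℝ ι))
    (f := (toEuclideanCLM (𝕜 := ℝ) T : EuclideanSpace ℝ ι →ₗ[ℝ] EuclideanSpace ℝ ι))
    (by rw [det_toEuclideanCLM, hdet]; exact hdet0.ne')
  rw [det_toEuclideanCLM, hdet, abs_of_pos (inv_pos.2 hdet0)] at hmap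
  have hmeas : Measurable (fun x : EuclideanSpace ℝ ι ↦
      ENNReal.ofReal (c * Real.exp (-(x.ofLp ⬝ᵥ S⁻¹ *ᵥ x.ofLp / 2)))) := by fun_prop
  rw [multivariateGaussian, h]
  simp only [zero_add]
  ext s hs
  have hTm : Measurable (toEuclideanCLM (𝕜 := ℝ) T) := by fun_prop
  rw [Measure.map_apply hTm hs, withDensity_apply _ (hTm hs), withDensity_apply _ hs]
  simp_rw [← hquad]
  rw [← setLIntegral_map hs hmeas hTm]
  change ∫⁻ x in s, _ ∂(Measure.map (toEuclideanCLM (𝕜 := ℝ) T :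
    EuclideanSpace ℝ ι →ₗ[ℝ] EuclideanSpace ℝ ι) volume) = _
  rw [hmap, Measure.restrict_smul, lintegral_smul_measure, smul_eq_mul,
    ← lintegral_const_mul _ hmeas]
  refine lintegral_congr fun x ↦ ?_
  rw [← ENNReal.ofReal_mul (by positivity)]
  congr 1
  ring

/-- The log-density of `N(T)` with respect to `N(S)`. -/
noncomputable def logDensity (S T : Matrix ι ι ℝ) (x : EuclideanSpace ℝ ι) : ℝ :=
  (Real.log S.det - Real.log T.det) / 2 + x.ofLp ⬝ᵥ (S⁻¹ - T⁻¹) *ᵥ x.ofLp / 2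

@[fun_prop]
theorem measurable_logDensity (S T : Matrix ι ι ℝ) : Measurable (logDensity S T) := by
  unfold logDensity
  fun_prop

theorem multivariateGaussian_eq_withDensity {S T : Matrix ι ι ℝ} (hS : S.PosDef) (hT : T.PosDef) :
    multivariateGaussian 0 T = (multivariateGaussian 0 S).withDensity
      (fun x ↦ ENNReal.ofReal (Real.exp (logDensity S T x))) := by
  obtain ⟨c, hc, h⟩ := exists_multivariateGaussian_eq_withDensity ι
  rw [h S hS, h T hT, ← withDensity_mul _ (by fun_prop) (by fun_prop)]
  congr 1
  ext x
  have hS0 := hS.det_pos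
  have hT0 := hT.det_pos
  rw [Pi.mul_apply, ← ENNReal.ofReal_mul (by positivity)]
  congr 1
  have e1 : √S.det = Real.exp (Real.log S.det / 2) := by
    rw [Real.exp_half, Real.exp_log hS0]
  have e2 : √T.det = Real.exp (Real.log T.det / 2) := by
    rw [Real.exp_half, Real.exp_log hT0]
  rw [logDensity, e1, e2, ← Real.exp_neg, ← Real.exp_neg, mul_assoc, mul_assoc, mul_assoc,
    ← Real.exp_add, ← Real.exp_add, ← Real.exp_add, sub_mulVec, dotProduct_sub]
  congr 2
  ring

end Density

/-! ### Coordinate marginals and second moments of Gaussians. -/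

section Moments

open Matrix

variable {ι κ : Type*} [Fintype ι] [DecidableEq ι] [Fintype κ] [DecidableEq κ]

theorem map_multivariateGaussian_of_eval {S : Matrix ι ι ℝ} (hS : S.PosSemidef) (f : κ → ι)
    (L : EuclideanSpace ℝ ι →L[ℝ] EuclideanSpace ℝ κ) (hL : ∀ x k, L x k = x (f k)) :
    (multivariateGaussian 0 S).map L = multivariateGaussian 0 (S.submatrix f f) := by
  apply IsGaussian.ext
  · simp only [id_eq, integral_id_multivariateGaussian]
    rw [ContinuousLinearMap.integral_id_map IsGaussian.integrable_id,
      integral_id_multivariateGaussian, map_zero]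
  rw [← ContinuousLinearMap.toBilinForm_inj]
  refine LinearMap.BilinForm.ext_basis (EuclideanSpace.basisFun κ ℝ).toBasis fun i j ↦ ?_
  rw [ContinuousLinearMap.toBilinForm_apply, ContinuousLinearMap.toBilinForm_apply,
    covarianceBilin_apply_eq_cov, covariance_map]
  · have (i : κ) : (fun u ↦ inner ℝ ((EuclideanSpace.basisFun κ ℝ).toBasis i) u) ∘ L =
        fun u ↦ u (f i) := by ext; simp [PiLp.inner_apply, hL]
    simp_rw [this, covariance_eval_multivariateGaussian hS,
      covarianceBilin_multivariateGaussian (hS.submatrix _)]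
    simp
  any_goals exact Measurable.aestronglyMeasurable (by fun_prop)
  · fun_prop
  · exact IsGaussian.memLp_two_id

theorem memLp_eval_multivariateGaussian (S : Matrix ι ι ℝ) (i : ι) :
    MemLp (fun x : EuclideanSpace ℝ ι ↦ x i) 2 (multivariateGaussian 0 S) :=
  (EuclideanSpace.proj (𝕜 := ℝ) i).comp_memLp' IsGaussian.memLp_two_id

theorem integrable_quadratic_multivariateGaussian (S P : Matrix ι ι ℝ) :
    Integrable (fun x : EuclideanSpace ℝ ι ↦ x.ofLp ⬝ᵥ P *ᵥ x.ofLp)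
      (multivariateGaussian 0 S) := by
  simp only [dotProduct, mulVec, Finset.mul_sum]
  refine integrable_finsetSum _ fun i _ ↦ integrable_finsetSum _ fun j _ ↦ ?_
  have := ((memLp_eval_multivariateGaussian S i).integrable_mul
    (memLp_eval_multivariateGaussian S j)).const_mul (P i j)
  refine this.congr (ae_of_all _ fun x ↦ ?_)
  simp only [Pi.mul_apply]
  ring

theorem integral_quadratic_multivariateGaussian {S : Matrix ι ι ℝ} (hS : S.PosSemidef)
    (P : Matrix ι ι ℝ) :
    ∫ x : EuclideanSpace ℝ ι, x.ofLp ⬝ᵥ P *ᵥ x.ofLp ∂(multivariateGaussian 0 S) =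
      (P * S).trace := by
  have hint (i j : ι) : Integrable (fun x : EuclideanSpace ℝ ι ↦ x i * x j)
      (multivariateGaussian 0 S) :=
    (memLp_eval_multivariateGaussian S i).integrable_mul (memLp_eval_multivariateGaussian S j)
  have hmean (i : ι) : ∫ x : EuclideanSpace ℝ ι, x i ∂(multivariateGaussian 0 S) = 0 := by
    have := (EuclideanSpace.proj (𝕜 := ℝ) i).integral_comp_id_comm
      (μ := multivariateGaussian 0 S) IsGaussian.integrable_id
    simpa using this
  have hcov (i j : ι) : ∫ x : EuclideanSpace ℝ ι, x i * x j ∂(multivariateGaussian 0 S) =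
      S i j := by
    have := covariance_eq_sub (memLp_eval_multivariateGaussian S i)
      (memLp_eval_multivariateGaussian S j)
    rw [covariance_eval_multivariateGaussian hS, hmean, zero_mul, sub_zero] at this
    exact this.symm
  obtain ⟨c, hc⟩ : ∃ c : ι → ι → ℝ, ∀ i j, P i j = c i j := ⟨_, fun _ _ ↦ rfl⟩
  have hsum (x : EuclideanSpace ℝ ι) : x.ofLp ⬝ᵥ P *ᵥ x.ofLp =
      ∑ i, ∑ j, c i j * (x j * x i) := by
    simp only [dotProduct, mulVec, Finset.mul_sum]
    exact Finset.sum_congr rfl fun i _ ↦ Finset.sum_congr rfl fun j _ ↦ by rw [hc]; ring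
  simp_rw [hsum]
  rw [integral_finsetSum _ fun i _ ↦ integrable_finsetSum _ fun j _ ↦ (hint j i).const_mul _]
  rw [trace]
  refine Finset.sum_congr rfl fun i _ ↦ ?_
  rw [integral_finsetSum _ fun j _ ↦ (hint j i).const_mul _, diag_apply, mul_apply]
  exact Finset.sum_congr rfl fun j _ ↦ by rw [integral_const_mul, hcov, hc]

end Moments

/-! ### Exponential densities as tilted measures. -/

section Tilt

variable {α β : Type*} {mα : MeasurableSpace α} {mβ : MeasurableSpace β}

theorem map_withDensity_comp (ρ : Measure α) {f : α → β} (hf : Measurable f) {g : β → ℝ≥0∞}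
    (hg : Measurable g) :
    (ρ.withDensity (fun x ↦ g (f x))).map f = (ρ.map f).withDensity g := by
  ext s hs
  rw [Measure.map_apply hf hs, withDensity_apply _ (hf hs), withDensity_apply _ hs,
    setLIntegral_map hs hg hf]

/-- The normalization is free: `ρ'` has total mass one, so no Gaussian integral has to be computed.
-/
theorem eq_tilted_of_eq_withDensity {ρ ρ' : Measure α} [IsProbabilityMeasure ρ']
    {G : α → ℝ} (hG : Measurable G)
    (h : ρ' = ρ.withDensity (fun x ↦ ENNReal.ofReal (Real.exp (G x)))) :
    Integrable (fun x ↦ Real.exp (G x)) ρ ∧ ∫ x, Real.exp (G x) ∂ρ = 1 ∧ ρ' = ρ.tilted G := by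
  have h1 : ∫⁻ x, ENNReal.ofReal (Real.exp (G x)) ∂ρ = 1 := by
    rw [← setLIntegral_univ, ← withDensity_apply _ MeasurableSet.univ, ← h, measure_univ]
  have hint : ∫ x, Real.exp (G x) ∂ρ = 1 := by
    rw [integral_eq_lintegral_of_nonneg_ae (ae_of_all _ fun x ↦ (Real.exp_pos _).le)
      (by fun_prop), h1, ENNReal.toReal_one]
  refine ⟨Integrable.of_integral_ne_zero (by rw [hint]; exact one_ne_zero), hint, ?_⟩
  rw [h, Measure.tilted, hint]
  simp only [div_one]

end Tilt

/-! ### Gaussian couplings and the separation of variables. -/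

section Joint

open Matrix

variable {d : ℕ} {S T : Matrix (Fin d ⊕ Fin d) (Fin d ⊕ Fin d) ℝ}

instance isGaussian_gaussian (A : Matrix (Fin d) (Fin d) ℝ) : IsGaussian (gaussian A) :=
  isGaussian_multivariateGaussian

instance isProbabilityMeasure_jointGaussian : IsProbabilityMeasure (jointGaussian S) :=
  Measure.isProbabilityMeasure_map (by fun_prop)

theorem jointGaussian_mem_couplings (hS : S.PosSemidef) :
    jointGaussian S ∈ couplings (gaussian S.toBlocks₁₁) (gaussian S.toBlocks₂₂) := by
  refine ⟨inferInstance, ?_, ?_⟩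
  · rw [jointGaussian, Measure.map_map (by fun_prop) (by fun_prop)]
    exact map_multivariateGaussian_of_eval hS Sum.inl
      ((ContinuousLinearMap.fst ℝ _ _).comp
        (EuclideanSpace.sumEquivProd (𝕜 := ℝ) (ι := Fin d) (κ := Fin d) :
          EuclideanSpace ℝ (Fin d ⊕ Fin d) →L[ℝ] Space d × Space d)) fun _ _ ↦ rfl
  · rw [jointGaussian, Measure.map_map (by fun_prop) (by fun_prop)]
    exact map_multivariateGaussian_of_eval hS Sum.inr
      ((ContinuousLinearMap.snd ℝ _ _).comp
        (EuclideanSpace.sumEquivProd (𝕜 := ℝ) (ι := Fin d) (κ := Fin d) :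
          EuclideanSpace ℝ (Fin d ⊕ Fin d) →L[ℝ] Space d × Space d)) fun _ _ ↦ rfl

/-- The log-density of `jointGaussian T` with respect to `jointGaussian S`. -/
noncomputable def jointLogDensity (S T : Matrix (Fin d ⊕ Fin d) (Fin d ⊕ Fin d) ℝ)
    (p : Space d × Space d) : ℝ :=
  logDensity S T ((EuclideanSpace.sumEquivProd (𝕜 := ℝ) (ι := Fin d) (κ := Fin d)).symm p)

@[fun_prop]
theorem measurable_jointLogDensity : Measurable (jointLogDensity S T) := by
  unfold jointLogDensity
  fun_prop

theorem jointGaussian_eq_withDensity (hS : S.PosDef) (hT : T.PosDef) :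
    jointGaussian T = (jointGaussian S).withDensity
      (fun p ↦ ENNReal.ofReal (Real.exp (jointLogDensity S T p))) := by
  rw [jointGaussian, jointGaussian, ← map_withDensity_comp _ (by fun_prop) (by fun_prop),
    multivariateGaussian_eq_withDensity hS hT]
  simp only [jointLogDensity, ContinuousLinearEquiv.symm_apply_apply]

/-- The off-diagonal part of `2ε` times the log-density is `2 x·y`, which cancels the `-2 x·y` of
the squared distance. -/
theorem cost_add_jointLogDensity (hS : S.PosDef) (hT : T.PosDef) {ε : ℝ} (hε : 0 < ε)
    (h : (T⁻¹).toBlocks₁₂ = -(ε⁻¹ • Meps ε S)) (p : Space d × Space d) :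
    ‖p.1 - p.2‖ ^ 2 + 2 * ε * jointLogDensity S T p =
      p.1.ofLp ⬝ᵥ (1 + ε • ((S⁻¹).toBlocks₁₁ - (T⁻¹).toBlocks₁₁)) *ᵥ p.1.ofLp +
      p.2.ofLp ⬝ᵥ (1 + ε • ((S⁻¹).toBlocks₂₂ - (T⁻¹).toBlocks₂₂)) *ᵥ p.2.ofLp +
      ε * (Real.log S.det - Real.log T.det) := by
  obtain ⟨x, y⟩ := p
  have h12 : (S⁻¹ - T⁻¹).toBlocks₁₂ = ε⁻¹ • 1 := by
    change (S⁻¹).toBlocks₁₂ - (T⁻¹).toBlocks₁₂ = _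
    rw [h, Meps, smul_sub, smul_smul, inv_mul_cancel₀ hε.ne']
    module
  have h21 : (S⁻¹ - T⁻¹).toBlocks₂₁ = ε⁻¹ • 1 := by
    rw [toBlocks₂₁_eq_transpose_of_isHermitian (hS.inv.isHermitian.sub hT.inv.isHermitian), h12]
    simp
  have hz : ((EuclideanSpace.sumEquivProd (𝕜 := ℝ) (ι := Fin d) (κ := Fin d)).symm (x, y)).ofLp =
      Sum.elim x.ofLp y.ofLp := by
    ext i
    cases i <;> rfl
  have hquad : Sum.elim x.ofLp y.ofLp ⬝ᵥ (S⁻¹ - T⁻¹) *ᵥ Sum.elim x.ofLp y.ofLp =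
      x.ofLp ⬝ᵥ ((S⁻¹).toBlocks₁₁ - (T⁻¹).toBlocks₁₁) *ᵥ x.ofLp +
      y.ofLp ⬝ᵥ ((S⁻¹).toBlocks₂₂ - (T⁻¹).toBlocks₂₂) *ᵥ y.ofLp +
      2 * ε⁻¹ * (x.ofLp ⬝ᵥ y.ofLp) := by
    conv_lhs => rw [← fromBlocks_toBlocks (S⁻¹ - T⁻¹), h12, h21]
    rw [fromBlocks_mulVec, sumElim_dotProduct_sumElim]
    simp only [Sum.elim_comp_inl, Sum.elim_comp_inr, smul_mulVec, one_mulVec, dotProduct_add,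
      dotProduct_smul, smul_eq_mul]
    rw [dotProduct_comm y.ofLp x.ofLp]
    change x.ofLp ⬝ᵥ ((S⁻¹).toBlocks₁₁ - (T⁻¹).toBlocks₁₁) *ᵥ x.ofLp + _ +
      (_ + y.ofLp ⬝ᵥ ((S⁻¹).toBlocks₂₂ - (T⁻¹).toBlocks₂₂) *ᵥ y.ofLp) = _
    ring
  have hnorm : ‖x - y‖ ^ 2 = x.ofLp ⬝ᵥ x.ofLp - 2 * (x.ofLp ⬝ᵥ y.ofLp) + y.ofLp ⬝ᵥ y.ofLp := by
    rw [EuclideanSpace.real_norm_sq_eq]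
    simp only [dotProduct, Finset.mul_sum, ← Finset.sum_sub_distrib, ← Finset.sum_add_distrib]
    exact Finset.sum_congr rfl fun i _ ↦ by simp only [PiLp.sub_apply]; ring
  rw [jointLogDensity, logDensity, hz, hquad, hnorm]
  simp only [add_mulVec, one_mulVec, smul_mulVec, dotProduct_add, dotProduct_smul, smul_eq_mul]
  field_simp
  ring

end Joint

/-! ### Integrals that depend only on the marginals. -/

section Couplings

open Matrix

variable {d : ℕ} {A B : Matrix (Fin d) (Fin d) ℝ} {π : Measure (Space d × Space d)}

theorem integrable_norm_sub_sq_of_mem_couplings (hπ : π ∈ couplings (gaussian A) (gaussian B)) :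
    Integrable (fun p ↦ ‖p.1 - p.2‖ ^ 2) π := by
  obtain ⟨_, h1, h2⟩ := hπ
  have m1 : MemLp (fun p : Space d × Space d ↦ p.1) 2 π := by
    have : MemLp id 2 (π.map Prod.fst) := by rw [h1]; exact IsGaussian.memLp_two_id
    exact this.comp_of_map measurable_fst.aemeasurable
  have m2 : MemLp (fun p : Space d × Space d ↦ p.2) 2 π := by
    have : MemLp id 2 (π.map Prod.snd) := by rw [h2]; exact IsGaussian.memLp_two_id
    exact this.comp_of_map measurable_snd.aemeasurable
  exact (memLp_two_iff_integrable_sq_norm (by fun_prop)).1 (m1.sub m2)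

theorem integrable_and_integral_quadratic_of_mem_couplings (hA : A.PosSemidef)
    (hB : B.PosSemidef) (hπ : π ∈ couplings (gaussian A) (gaussian B))
    (P Q : Matrix (Fin d) (Fin d) ℝ) (k : ℝ) :
    Integrable (fun p : Space d × Space d ↦
      p.1.ofLp ⬝ᵥ P *ᵥ p.1.ofLp + p.2.ofLp ⬝ᵥ Q *ᵥ p.2.ofLp + k) π ∧
    ∫ p, (p.1.ofLp ⬝ᵥ P *ᵥ p.1.ofLp + p.2.ofLp ⬝ᵥ Q *ᵥ p.2.ofLp + k) ∂π =
      (P * A).trace + (Q * B).trace + k := by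
  obtain ⟨_, h1, h2⟩ := hπ
  have i1 : Integrable (fun p : Space d × Space d ↦ p.1.ofLp ⬝ᵥ P *ᵥ p.1.ofLp) π := by
    have := integrable_quadratic_multivariateGaussian A P
    rw [← gaussian, ← h1] at this
    exact this.comp_measurable measurable_fst
  have i2 : Integrable (fun p : Space d × Space d ↦ p.2.ofLp ⬝ᵥ Q *ᵥ p.2.ofLp) π := by
    have := integrable_quadratic_multivariateGaussian B Q
    rw [← gaussian, ← h2] at this
    exact this.comp_measurable measurable_snd
  have e1 : ∫ p, p.1.ofLp ⬝ᵥ P *ᵥ p.1.ofLp ∂π = (P * A).trace := by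
    rw [← integral_quadratic_multivariateGaussian hA, ← gaussian, ← h1,
      integral_map measurable_fst.aemeasurable (by fun_prop)]
  have e2 : ∫ p, p.2.ofLp ⬝ᵥ Q *ᵥ p.2.ofLp ∂π = (Q * B).trace := by
    rw [← integral_quadratic_multivariateGaussian hB, ← gaussian, ← h2,
      integral_map measurable_snd.aemeasurable (by fun_prop)]
  refine ⟨(i1.add i2).add (integrable_const k), ?_⟩
  have h12 := integral_add (i1.add i2) (integrable_const k)
  simp only [Pi.add_apply] at h12
  rw [h12, integral_add i1 i2, e1, e2]
  simp

end Couplings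

/-! ### Duality and the value of the infimum. -/

section Cost

open Matrix

variable {d : ℕ} {S : Matrix (Fin d ⊕ Fin d) (Fin d ⊕ Fin d) ℝ} {ε : ℝ}

/-- Passage from `[0, ∞]` to real integrals; the mass correction in `klDiv` vanishes between
probability measures. -/
theorem objective_eq_ofReal {π : Measure (Space d × Space d)} [IsProbabilityMeasure π]
    (hε : 0 < ε) (hc : Integrable (fun p ↦ ‖p.1 - p.2‖ ^ 2) π)
    (hac : π ≪ jointGaussian S) (hint : Integrable (llr π (jointGaussian S)) π) :
    objective ε S π = ENNReal.ofReal
      (∫ p, ‖p.1 - p.2‖ ^ 2 ∂π + 2 * ε * ∫ p, llr π (jointGaussian S) p ∂π) ∧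
    0 ≤ ∫ p, ‖p.1 - p.2‖ ^ 2 ∂π + 2 * ε * ∫ p, llr π (jointGaussian S) p ∂π := by
  have h0 := integral_llr_add_sub_measure_univ_nonneg hac hint
  have hk := klDiv_of_ac_of_integrable hac hint
  simp only [probReal_univ, add_sub_cancel_right] at h0 hk
  have hc0 : 0 ≤ ∫ p, ‖p.1 - p.2‖ ^ 2 ∂π := integral_nonneg fun p ↦ by positivity
  refine ⟨?_, by positivity⟩
  rw [objective, hk, ← ENNReal.ofReal_mul (by positivity),
    ← ofReal_integral_eq_lintegral_ofReal hc (ae_of_all _ fun p ↦ by positivity),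
    ← ENNReal.ofReal_add hc0 (by positivity)]

theorem cost_eq {T : Matrix (Fin d ⊕ Fin d) (Fin d ⊕ Fin d) ℝ} (hS : S.PosDef) (hT : T.PosDef)
    (hε : 0 < ε) (h : (T⁻¹).toBlocks₁₂ = -(ε⁻¹ • Meps ε S)) {V : ℝ}
    (hV : V = ((1 + ε • ((S⁻¹).toBlocks₁₁ - (T⁻¹).toBlocks₁₁)) * T.toBlocks₁₁).trace +
      ((1 + ε • ((S⁻¹).toBlocks₂₂ - (T⁻¹).toBlocks₂₂)) * T.toBlocks₂₂).trace +
      ε * (Real.log S.det - Real.log T.det)) :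
    cost ε S (gaussian T.toBlocks₁₁) (gaussian T.toBlocks₂₂) = ENNReal.ofReal V ∧ 0 ≤ V := by
  have h11 : T.toBlocks₁₁.PosDef := hT.submatrix Sum.inl_injective
  have h22 : T.toBlocks₂₂.PosDef := hT.submatrix Sum.inr_injective
  obtain ⟨hexp, hexp1, htilt⟩ := eq_tilted_of_eq_withDensity measurable_jointLogDensity
    (jointGaussian_eq_withDensity hS hT)
  -- The dual functional takes the value `V` on every coupling, Gaussian or not.
  have hall (π : Measure (Space d × Space d))
      (hπ : π ∈ couplings (gaussian T.toBlocks₁₁) (gaussian T.toBlocks₂₂)) :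
      Integrable (jointLogDensity S T) π ∧
        ∫ p, ‖p.1 - p.2‖ ^ 2 ∂π + 2 * ε * ∫ p, jointLogDensity S T p ∂π = V := by
    have hc := integrable_norm_sub_sq_of_mem_couplings hπ
    obtain ⟨hi, hI⟩ := integrable_and_integral_quadratic_of_mem_couplings h11.posSemidef
      h22.posSemidef hπ (1 + ε • ((S⁻¹).toBlocks₁₁ - (T⁻¹).toBlocks₁₁))
      (1 + ε • ((S⁻¹).toBlocks₂₂ - (T⁻¹).toBlocks₂₂)) (ε * (Real.log S.det - Real.log T.det))
    simp_rw [← cost_add_jointLogDensity hS hT hε h] at hi hI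
    have hG : Integrable (jointLogDensity S T) π := by
      refine ((hi.sub hc).const_mul (2 * ε)⁻¹).congr (ae_of_all _ fun p ↦ ?_)
      simp only [Pi.sub_apply, add_sub_cancel_left]
      field_simp
    refine ⟨hG, ?_⟩
    rw [hV, ← hI, integral_add hc (hG.const_mul _), integral_const_mul]
  have hmem := jointGaussian_mem_couplings hT.posSemidef
  have hllr : llr (jointGaussian T) (jointGaussian S) =ᵐ[jointGaussian T]
      jointLogDensity S T := by
    rw [htilt]
    exact llr_tilted_self measurable_jointLogDensity hexp hexp1
  have hopt := objective_eq_ofReal hε (integrable_norm_sub_sq_of_mem_couplings hmem)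
    (htilt ▸ tilted_absolutelyContinuous _ _) ((hall _ hmem).1.congr hllr.symm)
  rw [integral_congr_ae hllr, (hall _ hmem).2] at hopt
  refine ⟨le_antisymm ((iInf₂_le _ hmem).trans_eq hopt.1) (le_iInf₂ fun π hπ ↦ ?_), hopt.2⟩
  have := hπ.1
  -- Infinite divergence makes the objective infinite because `ε > 0`; otherwise Gibbs' inequality
  -- applies.
  by_cases hkl : klDiv π (jointGaussian S) = ∞
  · simp [objective, hkl, ENNReal.mul_top, hε]
  obtain ⟨hac, hint⟩ := klDiv_ne_top_iff.1 hkl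
  rw [(objective_eq_ofReal hε (integrable_norm_sub_sq_of_mem_couplings hπ) hac hint).1,
    ← (hall π hπ).2]
  have := integral_le_integral_llr hexp hexp1 (hall π hπ).1 hac hint
  gcongr

end Cost

end GaussianEOT

/-! ### Evaluation of the closed formula. -/

open Matrix in
theorem mainTheorem2 (d : ℕ) (A B : Matrix (Fin d) (Fin d) ℝ) (hA : A.PosDef) (hB : B.PosDef)
    (S : Matrix (Fin d ⊕ Fin d) (Fin d ⊕ Fin d) ℝ) (hS : S.PosDef) (ε : ℝ) (hε : 0 < ε) :
    GaussianEOT.cost ε S (GaussianEOT.gaussian A) (GaussianEOT.gaussian B) ≠ ∞ ∧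
    (GaussianEOT.cost ε S (GaussianEOT.gaussian A) (GaussianEOT.gaussian B)).toReal =
      A.trace + B.trace
        - 2 * (GaussianEOT.regRoot ε A B (GaussianEOT.Meps ε S)).trace
        + ε * Real.log
            (GaussianEOT.regRoot ε A B (GaussianEOT.Meps ε S) + (ε / 2) • 1).det
        + ε * ((S⁻¹).toBlocks₁₁ * A).trace
        + ε * ((S⁻¹).toBlocks₂₂ * B).trace
        - ε * Real.log (A * B).det
        - ε * d
        - ε * d * Real.log ε
        - ε * Real.log (S⁻¹).det ∧
    GaussianEOT.Meps ε S =
      1 + ε • ((S.toBlocks₁₁)⁻¹ * S.toBlocks₁₂ *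
        (S.toBlocks₂₂ - (S.toBlocks₁₂)ᵀ * (S.toBlocks₁₁)⁻¹ * S.toBlocks₁₂)⁻¹) := by
  obtain ⟨T, hT, h11, h22, h12, htr, hdet0, hdet⟩ :=
    GaussianEOT.exists_coupling_covariance hA hB (GaussianEOT.Meps ε S) hε
  obtain ⟨hcost, hV0⟩ := GaussianEOT.cost_eq hS hT hε h12 rfl
  rw [h11, h22] at hcost hV0
  refine ⟨by rw [hcost]; exact ENNReal.ofReal_ne_top, ?_, ?_⟩
  · rw [hcost, ENNReal.toReal_ofReal hV0]
    set M := GaussianEOT.Meps ε S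
    set r := (GaussianEOT.regRoot ε A B M + (ε / 2) • 1).det
    have h21 := GaussianEOT.toBlocks₂₁_eq_transpose_of_isHermitian hT.isHermitian
    have h21' := GaussianEOT.toBlocks₂₁_eq_transpose_of_isHermitian hT.inv.isHermitian
    have hblocks (X Y : Matrix (Fin d ⊕ Fin d) (Fin d ⊕ Fin d) ℝ) (hXY : X * Y = 1) :
        X.toBlocks₁₁ * Y.toBlocks₁₁ + X.toBlocks₁₂ * Y.toBlocks₂₁ = 1 ∧
        X.toBlocks₂₁ * Y.toBlocks₁₂ + X.toBlocks₂₂ * Y.toBlocks₂₂ = 1 := by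
      rw [← fromBlocks_toBlocks X, ← fromBlocks_toBlocks Y, fromBlocks_multiply,
        ← fromBlocks_one, fromBlocks_inj] at hXY
      exact ⟨hXY.1, hXY.2.2.2⟩
    -- The diagonal blocks of `T⁻¹ T = 1` show that `tr((T⁻¹)₁₁ A)` and `tr((T⁻¹)₂₂ B)` both equal
    -- `d + ε⁻¹ tr(M Cᵀ)`, with `C = T.toBlocks₁₂`.
    obtain ⟨e1, e2⟩ := hblocks _ _
      (nonsing_inv_mul _ ((isUnit_iff_isUnit_det _).1 hT.isUnit))
    replace e1 := congrArg trace e1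
    replace e2 := congrArg trace e2
    have htr' : (Mᵀ * T.toBlocks₁₂).trace = (M * (T.toBlocks₁₂)ᵀ).trace := by
      rw [← trace_transpose, transpose_mul, transpose_transpose, trace_mul_comm]
    rw [h21, h12, h11] at e1
    rw [h21', h12, h22] at e2
    simp only [trace_add, trace_neg, trace_smul, neg_mul, smul_mul_assoc, transpose_neg,
      transpose_smul, trace_one, Fintype.card_fin, smul_eq_mul, htr', htr] at e1 e2
    have hA0 := hA.det_pos
    have hB0 := hB.det_pos
    have hlog := congrArg Real.log hdet
    rw [Real.log_mul hT.det_pos.ne' hdet0.ne', Real.log_mul (by positivity) (by positivity),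
      Real.log_mul hA0.ne' hB0.ne', Real.log_pow] at hlog
    rw [det_mul, Real.log_mul hA0.ne' hB0.ne', det_nonsing_inv, Ring.inverse_eq_inv',
      Real.log_inv]
    simp only [add_mul, one_mul, smul_mul_assoc, sub_mul, trace_add, trace_smul, trace_sub,
      smul_eq_mul]
    linear_combination -ε * hlog - ε * e1 - ε * e2 -
      2 * ((GaussianEOT.regRoot ε A B M).trace - ε / 2 * d) * mul_inv_cancel₀ hε.ne'
  · rw [GaussianEOT.Meps, GaussianEOT.inv_toBlocks₁₂_of_posDef hS, smul_neg, sub_neg_eq_add]
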